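/- Let $S$ and $A$ be Borel spaces (i.e. homeomorphic to Borel subsets of complete separable metric spaces), with Borel $\sigma$-algebras. For each $s\in S$ let $A(s)\subseteq A$ be a Borel set such that $K=\{(s,a)\in S\times A: a\in A(s)\}$ is closed in $S\times A$. Let $Q(\cdot\mid s,a)$ be a stochastic kernel on $S$ given $K$, let $r,z:K\to\mathbb R$ be measurable, and let $Y$ be a real random variable with values almost surely in a compact interval $[a,b]$. Write $(x)_-=\min\{x,0\}$. Let $\Pi$ be the set of history-dependent randomized policies $\pi=(\pi_t)_{t\ge0}$, where $\pi_t$ is a stochastic kernel on $A$ given $K^t\times S$ with $\pi_t(A(s_t)\mid h_t)=1$ for every history $h_t=(s_0,a_0,\dots,s_{t-1},a_{t-1},s_t)$. Let $\Phi\subseteq\Pi$ be the set of stationary randomized Markov policies, i.e. stochastic kernels $\phi$ on $A$ given $S$ with $\phi(A(s)\mid s)=1$ for all $s\in S$. For $\pi\in\Pi$ and an initial distribution $\nu\in\mathcal P(S)$, let $\mathbb E^\pi_\nu$ be the expectation for the induced state-action process $(s_t,a_t)_{t\ge0}$, and put $$R(\pi,\nu)=\liminf_{T\to\infty}\frac1T\,\mathbb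 E_\nu^\pi\Big[\sum_{t=0}^{T-1}r(s_t,a_t)\Big],\qquad Z_\eta(\pi,\nu)=\liminf_{T\to\infty}\frac1T\,\mathbb E_\nu^\pi\Big[\sum_{t=0}^{T-1}(z(s_t,a_t)-\eta)_-\Big],$$ with values in $[-\infty,\infty]$. Let $$\Delta=\big\{(\pi,\nu)\in\Pi\times\mathcal P(S): R(\pi,\nu)>-\infty\ \text{and}\ Z_\eta(\pi,\nu)\ge\mathbb E[(Y-\eta)_-]\ \text{for all }\eta\in[a,b]\big\},\qquad \rho^*=\sup_{(\pi,\nu)\in\Delta}R(\pi,\nu).$$ Assume that (a) $\Delta\neq\emptyset$; (b) $r\le 0$, and for every $\epsilon\ge0$ the set $\{(s,a)\in K: r(s,a)\ge-\epsilon\}$ is compact; (c) $z$ is bounded and upper semicontinuous on $K$; (d) $Q$ is weakly continuous: $(s,a)\mapsto\int_S h(\xi)\,Q(d\xi\mid s,a)$ is continuous and bounded on $K$ for every bounded continuous $h:S\to\mathbb R$. Then the problem of maximizing $R(\pi,\nu)$ over $(\pi,\nu)\in\Delta$ is solvable, that is, there is $(\pi^*,\nu^*)\in\Delta$ with $R(\pi^*,\nu^*)=\rho^*$.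 Moreover, the optimum is attained by a stationary policy with a stable measure: there are $\phi\in\Phi$ and a probability measure $\mu$ on $K$, with marginal $\hat\mu$ on $S$, such that (i) $\mu(B\times C)=\int_B\phi(C\mid s)\,\hat\mu(ds)$ for all Borel $B\subseteq S$, $C\subseteq A$, where $\mu$ is regarded as a measure on $S\times A$ carried by $K$; (ii) $\int_K r\,d\mu>-\infty$, and $\hat\mu(B)=\int_S\int_{A}Q(B\mid s,a)\,\phi(da\mid s)\,\hat\mu(ds)$ for all Borel $B\subseteq S$; (iii) $(\phi,\hat\mu)\in\Delta$ and $R(\phi,\hat\mu)=\int_K r\,d\mu=\rho^*$. -/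

import Mathlib

open MeasureTheory ProbabilityTheory Filter Topology
open scoped ENNReal BoundedContinuousFunction

set_option linter.unusedSectionVars false

noncomputable section

/-- The graph `{(s, a) : a ∈ act s}` of a family of sets of feasible actions. -/
def feasiblePairs {S A : Type*} (act : S → Set A) : Set (S × A) :=
  {p | p.2 ∈ act p.1}

/-- A discrete-time Markov decision process `(S, A, {A(s)}, Q, r)`: the sets `act s` of feasible
actions are Borel, the set `K` of feasible state-action pairs is closed, `Q` is a stochastic
kernel from `K` to `S`, and the reward `r : K → ℝ` is measurable. -/
structure MDP (S A : Type*) [TopologicalSpace S] [MeasurableSpace S]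
    [TopologicalSpace A] [MeasurableSpace A] where
  act : S → Set A
  measurableSet_act : ∀ s, MeasurableSet (act s)
  isClosed_feasiblePairs : IsClosed (feasiblePairs act)
  Q : Kernel (feasiblePairs act) S
  isMarkovKernel_Q : IsMarkovKernel Q
  r : feasiblePairs act → ℝ
  measurable_r : Measurable r

/-- The expectation of a real function with values in `[-∞, ∞]`, as the difference of the
integrals of the positive and negative parts. -/
def extExpectation {α : Type*} [MeasurableSpace α] (μ : Measure α) (f : α → ℝ) : EReal :=
  ((∫⁻ x, ENNReal.ofReal (f x) ∂μ : ℝ≥0∞) : EReal) -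
    ((∫⁻ x, ENNReal.ofReal (-f x) ∂μ : ℝ≥0∞) : EReal)

namespace MDP

variable {S A : Type*}
  [TopologicalSpace S] [TopologicalSpace.MetrizableSpace S] [SecondCountableTopology S]
  [MeasurableSpace S] [BorelSpace S]
  [TopologicalSpace A] [TopologicalSpace.MetrizableSpace A] [SecondCountableTopology A]
  [MeasurableSpace A] [BorelSpace A]

/-- The set of feasible state-action pairs. -/
abbrev K (M : MDP S A) : Set (S × A) := feasiblePairs M.act

instance (M : MDP S A) : IsMarkovKernel M.Q := M.isMarkovKernel_Q

theorem measurableSet_K (M : MDP S A) : MeasurableSet M.K :=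
  M.isClosed_feasiblePairs.measurableSet

/-- If an action is drawn from `κ x`, which is carried by the actions feasible in the state
`st x`, then `pairKernel κ st x` is the law of the pair (state, action), as a law on `K`. -/
def pairKernel (M : MDP S A) {X : Type*} [MeasurableSpace X] (κ : Kernel X A)
    (st : X → S) (hst : Measurable st) : Kernel X M.K :=
  (Kernel.deterministic st hst ×ₖ κ).comapRight (MeasurableEmbedding.subtype_coe M.measurableSet_K)

theorem isMarkovKernel_pairKernel (M : MDP S A) {X : Type*} [MeasurableSpace X] (κ : Kernel X A)
    [IsMarkovKernel κ] (st : X → S) (hst : Measurable st) (h : ∀ x, κ x (M.act (st x)) = 1) :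
    IsMarkovKernel (M.pairKernel κ st hst) := by
  refine Kernel.IsMarkovKernel.comapRight _ _ fun x => ?_
  rw [Subtype.range_coe, Kernel.prod_apply, Kernel.deterministic_apply,
    Measure.prod_apply M.measurableSet_K,
    lintegral_dirac' _ (measurable_measure_prodMk_left M.measurableSet_K)]
  exact h x

/-- A history at time `t`: the pairs in `K` visited at times `0, …, t - 1` and the current state. -/
abbrev History (M : MDP S A) (t : ℕ) : Type _ := (Fin t → M.K) × S

/-- History-dependent randomized policies respecting the constraint set `K`. -/
structure Policy (M : MDP S A) where
  dist : ∀ t : ℕ, Kernel (M.History t) A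
  isMarkovKernel_dist : ∀ t, IsMarkovKernel (dist t)
  feasible : ∀ t (h : M.History t), dist t h (M.act h.2) = 1

/-- Stationary randomized Markov policies respecting the constraint set `K`. -/
structure StationaryPolicy (M : MDP S A) where
  dist : Kernel S A
  isMarkovKernel_dist : IsMarkovKernel dist
  feasible : ∀ s, dist s (M.act s) = 1

variable {M : MDP S A}

instance (π : M.Policy) (t : ℕ) : IsMarkovKernel (π.dist t) := π.isMarkovKernel_dist t

instance (φ : M.StationaryPolicy) : IsMarkovKernel φ.dist := φ.isMarkovKernel_dist

/-- A stationary policy, viewed as a history-dependent one that only uses the current state. -/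
def StationaryPolicy.toPolicy (φ : M.StationaryPolicy) : M.Policy where
  dist _ := φ.dist.comap Prod.snd measurable_snd
  isMarkovKernel_dist _ := inferInstance
  feasible _ h := φ.feasible h.2

/-- The conditional law of `(s_t, a_t)` given the history at time `t`. -/
def Policy.pairLaw (π : M.Policy) (t : ℕ) : Kernel (M.History t) M.K :=
  M.pairKernel (π.dist t) Prod.snd measurable_snd

instance (π : M.Policy) (t : ℕ) : IsMarkovKernel (π.pairLaw t) :=
  isMarkovKernel_pairKernel M (π.dist t) _ measurable_snd (π.feasible t)

/-- The conditional law of `(s_t, a_t)` given `s_t`, under a stationary policy. -/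
def StationaryPolicy.pairLaw (φ : M.StationaryPolicy) : Kernel S M.K :=
  M.pairKernel φ.dist id measurable_id

instance (φ : M.StationaryPolicy) : IsMarkovKernel φ.pairLaw :=
  isMarkovKernel_pairKernel M φ.dist _ measurable_id φ.feasible

/-- The conditional law of `(s_{n+1}, a_{n+1})` given `(s_0, a_0), …, (s_n, a_n)`: the state
`s_{n+1}` is drawn from `Q (· | s_n, a_n)`, then `a_{n+1}` from the policy. -/
def Policy.step (π : M.Policy) (n : ℕ) : Kernel (Finset.Iic n → M.K) M.K :=
  π.pairLaw (n + 1) ∘ₖ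
    (Kernel.deterministic
        (fun (x : Finset.Iic n → M.K) (i : Fin (n + 1)) =>
          x ⟨i, Finset.mem_Iic.2 (Nat.lt_succ_iff.1 i.2)⟩)
        (measurable_pi_lambda _ fun _ => measurable_pi_apply _) ×ₖ
      M.Q.comap (fun x : Finset.Iic n → M.K => x ⟨n, Finset.mem_Iic.2 le_rfl⟩)
        (measurable_pi_apply _))

instance (π : M.Policy) (n : ℕ) : IsMarkovKernel (π.step n) := by
  unfold Policy.step; infer_instance

/-- The law of `(s_0, a_0)` under the policy `π` and the initial distribution `ν`. -/
def Policy.initialLaw (π : M.Policy) (ν : ProbabilityMeasure S) : Measure M.K :=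
  π.pairLaw 0 ∘ₘ (ν : Measure S).map fun s => ((Fin.elim0 : Fin 0 → M.K), s)

/-- The law `P_ν^π` of the process `(s_t, a_t)_{t ≥ 0}` on the canonical space of sequences in `K`
(Ionescu-Tulcea). -/
def Policy.pathMeasure (π : M.Policy) (ν : ProbabilityMeasure S) : Measure (ℕ → M.K) :=
  Kernel.trajMeasure (X := fun _ => M.K) (π.initialLaw ν) π.step

/-- The long-run expected average `liminf_T (1/T) E_ν^π [∑_{t < T} f (s_t, a_t)]`. -/
def longRunAverage (f : M.K → ℝ) (π : M.Policy) (ν : ProbabilityMeasure S) : EReal :=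
  liminf (fun T : ℕ =>
    ((1 / (T : ℝ) : ℝ) : EReal) *
      extExpectation (π.pathMeasure ν) (fun ω => ∑ t ∈ Finset.range T, f (ω t))) atTop

/-- The long-run expected average reward `R(π, ν)`. -/
def avgReward (π : M.Policy) (ν : ProbabilityMeasure S) : EReal :=
  longRunAverage M.r π ν

/-- The long-run expected average shortfall `Z_η(π, ν)` in `z` at level `η`. -/
def avgShortfall (z : M.K → ℝ) (η : ℝ) (π : M.Policy) (ν : ProbabilityMeasure S) : EReal :=
  longRunAverage (fun k => min (z k - η) 0) π ν

/-- The feasible region `Δ` of the dominance-constrained problem with benchmark `Y`. -/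
def feasibleRegion (M : MDP S A) (z : M.K → ℝ) {Ω : Type*} [MeasurableSpace Ω] (P : Measure Ω)
    (Y : Ω → ℝ) (a b : ℝ) : Set (M.Policy × ProbabilityMeasure S) :=
  {p | ⊥ < avgReward p.1 p.2 ∧
    ∀ η ∈ Set.Icc a b, ((∫ ω, min (Y ω - η) 0 ∂P : ℝ) : EReal) ≤ avgShortfall z η p.1 p.2}

/-- The optimal value `ρ*`. -/
def optimalValue (M : MDP S A) (z : M.K → ℝ) {Ω : Type*} [MeasurableSpace Ω] (P : Measure Ω)
    (Y : Ω → ℝ) (a b : ℝ) : EReal :=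
  sSup ((fun p : M.Policy × ProbabilityMeasure S => avgReward p.1 p.2) ''
    M.feasibleRegion z P Y a b)

/-- The problem is solvable: the optimal value is attained by a feasible pair. -/
def IsSolvable (M : MDP S A) (z : M.K → ℝ) {Ω : Type*} [MeasurableSpace Ω] (P : Measure Ω)
    (Y : Ω → ℝ) (a b : ℝ) : Prop :=
  ∃ p ∈ M.feasibleRegion z P Y a b, avgReward p.1 p.2 = M.optimalValue z P Y a b

/-- `Q` is weakly continuous: `(s, a) ↦ ∫ h(ξ) Q(dξ | s, a)` is continuous on `K` for every bounded
continuous `h` on `S` (it is automatically bounded). -/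
def WeaklyContinuous (M : MDP S A) : Prop :=
  ∀ h : S →ᵇ ℝ, Continuous fun k : M.K => ∫ ξ, h ξ ∂(M.Q k)

/-- The marginal on `S` of a probability measure on `K`. -/
def marginal (μ : ProbabilityMeasure M.K) : ProbabilityMeasure S :=
  μ.map (f := fun k : M.K => k.1.1) (measurable_fst.comp measurable_subtype_coe).aemeasurable

/-- `μ = μ̂ · φ`: for Borel `B ⊆ S` and `C ⊆ A`, `μ(B × C) = ∫_B φ(C | s) μ̂(ds)`. -/
def Disintegrates (μ : ProbabilityMeasure M.K) (φ : M.StationaryPolicy) : Prop :=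
  ∀ (B : Set S) (C : Set A), MeasurableSet B → MeasurableSet C →
    (μ : Measure M.K) {k | k.1.1 ∈ B ∧ k.1.2 ∈ C} =
      ∫⁻ s in B, φ.dist s C ∂(marginal μ : Measure S)

/-- The measure `μ = μ̂ · φ` is stable: `⟨μ, r⟩ > -∞`, and `μ̂` is invariant for the kernel
`Q(· | s, φ) = ∫ Q(· | s, a) φ(da | s)`. -/
structure IsStable (μ : ProbabilityMeasure M.K) (φ : M.StationaryPolicy) : Prop where
  disintegrates : Disintegrates μ φ
  reward_gt_bot : ⊥ < extExpectation (μ : Measure M.K) M.r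
  invariant : ∀ B : Set S, MeasurableSet B →
    (marginal μ : Measure S) B =
      ∫⁻ s, (∫⁻ k, M.Q k B ∂(φ.pairLaw s)) ∂(marginal μ : Measure S)

end MDP

end

noncomputable section

/-! ### Weak convergence of probability measures -/

section WeakConvergence

open Set

variable {X : Type*} [TopologicalSpace X] [TopologicalSpace.MetrizableSpace X]
  [SecondCountableTopology X] [MeasurableSpace X] [BorelSpace X]

/-! The problem is equivalent to a static one over measures `μ` on `K` that satisfy the flow balance
`μ̂ = μ Q`.

From policies to measures: if the average reward exceeds a real `c`, the occupation measures
eventually satisfy `⟨μ, r⟩ ≥ c`. Since `r` has compact superlevel sets, these measures lie in a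
compact set (`isCompact_setOf_le_extExpectation`). A limit point is balanced, because the flow
defect telescopes and `Q` is weakly continuous. As `μ ↦ ⟨μ, f⟩` is upper semicontinuous for `f ≤ 0`
upper semicontinuous, the same limit point dominates the long-run averages of `r` and of all the
shortfalls (`exists_isBalanced_longRunAverage_le`).

From measures to policies: disintegrating a balanced `μ` gives a stationary `φ` under which, started
from `μ̂`, every `(s_t, a_t)` has law `μ`, so long-run averages equal expectations
(`StationaryPolicy.longRunAverage_toPolicy`).

It remains to maximize the upper semicontinuous `⟨μ, r⟩` over the closed set of balanced measures
meeting the constraints, whose part with `⟨μ, r⟩ ≥ c` is compact. -/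

theorem lowerSemicontinuous_lintegral_ofReal {g : X → ℝ} (hg : LowerSemicontinuous g)
    (hg0 : ∀ x, 0 ≤ g x) :
    LowerSemicontinuous fun μ : ProbabilityMeasure X =>
      ∫⁻ x, ENNReal.ofReal (g x) ∂(μ : Measure X) := by
  intro μ y hy
  -- Working along sequences makes Fatou's lemma available. It is applied in the layer-cake formula,
  -- where each set `{t < g}` is open and the portmanteau inequality holds.
  refine Filter.eventually_iff_seq_eventually.2 fun u hu => ?_
  have key : ∫⁻ x, ENNReal.ofReal (g x) ∂(μ : Measure X) ≤
      liminf (fun n => ∫⁻ x, ENNReal.ofReal (g x) ∂(u n : Measure X)) atTop := by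
    have h (ν : ProbabilityMeasure X) := lintegral_eq_lintegral_meas_lt (ν : Measure X)
      (f := g) (Eventually.of_forall hg0) hg.measurable.aemeasurable
    simp_rw [h]
    calc ∫⁻ t in Ioi (0 : ℝ), (μ : Measure X) {a | t < g a}
        ≤ ∫⁻ t in Ioi (0 : ℝ), liminf (fun n => (u n : Measure X) {a | t < g a}) atTop :=
          lintegral_mono fun t =>
            ProbabilityMeasure.le_liminf_measure_open_of_tendsto hu (hg.isOpen_preimage t)
      _ ≤ _ := lintegral_liminf_le fun n => Antitone.measurable fun s t hst =>
          measure_mono fun x hx => lt_of_le_of_lt hst hx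
  exact eventually_lt_of_lt_liminf (hy.trans_le key)

theorem extExpectation_of_nonpos {α : Type*} [MeasurableSpace α] (μ : Measure α) {f : α → ℝ}
    (hf : ∀ x, f x ≤ 0) :
    extExpectation μ f = -((∫⁻ x, ENNReal.ofReal (-f x) ∂μ : ℝ≥0∞) : EReal) := by
  simp [extExpectation, ENNReal.ofReal_of_nonpos (hf _)]

theorem upperSemicontinuous_extExpectation {f : X → ℝ} (hf : UpperSemicontinuous f)
    (hf0 : ∀ x, f x ≤ 0) :
    UpperSemicontinuous fun μ : ProbabilityMeasure X => extExpectation (μ : Measure X) f := by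
  simp_rw [extExpectation_of_nonpos _ hf0]
  have h := lowerSemicontinuous_lintegral_ofReal (g := fun x => -f x)
    (continuous_neg.comp_upperSemicontinuous_antitone hf fun _ _ h => neg_le_neg h)
    (fun x => neg_nonneg.2 (hf0 x))
  exact (continuous_neg.comp continuous_coe_ennreal_ereal).comp_lowerSemicontinuous_antitone h
    fun _ _ h => EReal.neg_le_neg_iff.2 (EReal.coe_ennreal_le_coe_ennreal_iff.2 h)

theorem upperSemicontinuous_of_isCompact_superlevel {f : X → ℝ} (hf0 : ∀ x, f x ≤ 0)
    (hf : ∀ ε : ℝ, 0 ≤ ε → IsCompact {x | -ε ≤ f x}) : UpperSemicontinuous f := by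
  refine upperSemicontinuous_iff_isClosed_preimage.2 fun y => ?_
  rcases le_or_gt y 0 with hy | hy
  · simpa [preimage, Ici] using (hf (-y) (neg_nonneg.2 hy)).isClosed
  · convert isClosed_empty
    ext x
    simpa using (hf0 x).trans_lt hy

/-- Markov's inequality bounds the mass outside the compact set `{f ≥ -n}` by `-c / n`, uniformly in
the measure. The set is therefore tight, and Prokhorov's theorem applies; closedness comes from
upper semicontinuity. -/
theorem isCompact_setOf_le_extExpectation {f : X → ℝ} (hf0 : ∀ x, f x ≤ 0)
    (hf : ∀ ε : ℝ, 0 ≤ ε → IsCompact {x | -ε ≤ f x}) (c : ℝ) :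
    IsCompact {μ : ProbabilityMeasure X | (c : EReal) ≤ extExpectation (μ : Measure X) f} := by
  have husc := upperSemicontinuous_of_isCompact_superlevel hf0 hf
  have hcl : IsClosed
      {μ : ProbabilityMeasure X | (c : EReal) ≤ extExpectation (μ : Measure X) f} :=
    (upperSemicontinuous_extExpectation husc hf0).isClosed_preimage _
  rw [← hcl.closure_eq]
  refine isCompact_closure_of_isTightMeasureSet
    (isTightMeasureSet_iff_exists_isCompact_measure_compl_le.2 fun ε hε => ?_)
  have hlim : Tendsto (fun n : ℕ => ENNReal.ofReal (-c) / (n : ℝ≥0∞)) atTop (𝓝 0) := by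
    simpa using ENNReal.Tendsto.const_div ENNReal.tendsto_nat_nhds_top
      (Or.inr ENNReal.ofReal_ne_top)
  obtain ⟨n, hn, hn0⟩ := ((hlim.eventually_le_const hε).and (eventually_gt_atTop 0)).exists
  refine ⟨{x | -(n : ℝ) ≤ f x}, hf n n.cast_nonneg, ?_⟩
  rintro _ ⟨μ, hμ, rfl⟩
  have hI : ∫⁻ x, ENNReal.ofReal (-f x) ∂(μ : Measure X) ≤ ENNReal.ofReal (-c) := by
    have h : (c : EReal) ≤ extExpectation (μ : Measure X) f := hμ
    rw [extExpectation_of_nonpos _ hf0, EReal.le_neg] at h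
    rw [← EReal.coe_ennreal_le_coe_ennreal_iff]
    exact h.trans (by rw [EReal.coe_ennreal_ofReal, ← EReal.coe_neg]; exact_mod_cast le_max_left _ _)
  calc (μ : Measure X) {x | -(n : ℝ) ≤ f x}ᶜ
      ≤ (μ : Measure X) {x | (n : ℝ≥0∞) ≤ ENNReal.ofReal (-f x)} := by
        refine measure_mono fun x hx => ?_
        rw [mem_ofPred_eq, ← ENNReal.ofReal_natCast]
        refine ENNReal.ofReal_le_ofReal ?_
        have : f x < -n := not_le.1 hx
        linarith
    _ ≤ (∫⁻ x, ENNReal.ofReal (-f x) ∂(μ : Measure X)) / n :=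
        meas_ge_le_lintegral_div husc.measurable.neg.ennreal_ofReal.aemeasurable
          (by exact_mod_cast hn0.ne') (ENNReal.natCast_ne_top n)
    _ ≤ ENNReal.ofReal (-c) / n := by gcongr
    _ ≤ ε := hn

/-- The probability measure obtained by composing a probability measure with a Markov kernel. -/
def MeasureTheory.ProbabilityMeasure.compKernel {X Y : Type*} [MeasurableSpace X]
    [MeasurableSpace Y] (κ : Kernel X Y) [IsMarkovKernel κ] (μ : ProbabilityMeasure X) :
    ProbabilityMeasure Y :=
  ⟨κ ∘ₘ (μ : Measure X), inferInstance⟩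

theorem MeasureTheory.ProbabilityMeasure.coe_compKernel {X Y : Type*} [MeasurableSpace X]
    [MeasurableSpace Y] (κ : Kernel X Y) [IsMarkovKernel κ] (μ : ProbabilityMeasure X) :
    (μ.compKernel κ : Measure Y) = κ ∘ₘ (μ : Measure X) := rfl

/-- The integral of a bounded continuous function against a weakly continuous Markov kernel. -/
def ProbabilityTheory.Kernel.integralBCF {Y : Type*} [TopologicalSpace Y] [MeasurableSpace Y]
    [BorelSpace Y] (κ : Kernel X Y) [IsMarkovKernel κ]
    (hκ : ∀ h : Y →ᵇ ℝ, Continuous fun x => ∫ y, h y ∂κ x) (h : Y →ᵇ ℝ) : X →ᵇ ℝ :=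
  BoundedContinuousFunction.ofNormedAddCommGroup _ (hκ h) ‖h‖ fun x =>
    h.norm_integral_le_norm (κ x)

theorem integral_compKernel {Y : Type*} [TopologicalSpace Y]
    [TopologicalSpace.MetrizableSpace Y] [MeasurableSpace Y]
    [BorelSpace Y] (κ : Kernel X Y) [IsMarkovKernel κ] (μ : ProbabilityMeasure X) (h : Y →ᵇ ℝ) :
    ∫ y, h y ∂(μ.compKernel κ : Measure Y) = ∫ x, ∫ y, h y ∂κ x ∂(μ : Measure X) := by
  have hi := h.integrable (μ.compKernel κ : Measure Y)
  rw [ProbabilityMeasure.coe_compKernel, Measure.comp_eq_comp_const_apply] at hi ⊢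
  rw [Kernel.integral_comp hi, Kernel.const_apply]

/-- Testing `κ ∘ₘ μ` against `h` amounts to testing `μ` against `x ↦ ∫ h dκ x`, which is again
bounded and continuous. -/
theorem continuous_compKernel {Y : Type*} [TopologicalSpace Y]
    [TopologicalSpace.MetrizableSpace Y] [MeasurableSpace Y]
    [BorelSpace Y] (κ : Kernel X Y) [IsMarkovKernel κ]
    (hκ : ∀ h : Y →ᵇ ℝ, Continuous fun x => ∫ y, h y ∂κ x) :
    Continuous fun μ : ProbabilityMeasure X => μ.compKernel κ := by
  refine ProbabilityMeasure.continuous_iff_forall_continuous_integral.2 fun h => ?_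
  simp_rw [integral_compKernel]
  exact ProbabilityMeasure.continuous_integral_boundedContinuousFunction (κ.integralBCF hκ h)

end WeakConvergence

/-! ### The state-action process -/

theorem map_eval_zero_trajMeasure {X : Type*} [MeasurableSpace X] (μ₀ : Measure X)
    (κ : (n : ℕ) → Kernel (Finset.Iic n → X) X) [∀ n, IsMarkovKernel (κ n)] :
    (Kernel.trajMeasure (X := fun _ => X) μ₀ κ).map (fun x => x 0) = μ₀ := by
  have h0 : (fun x : ℕ → X => x 0) =
      (fun y : Finset.Iic 0 → X => y ⟨0, Finset.mem_Iic.2 le_rfl⟩) ∘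
        Preorder.frestrictLe (π := fun _ => X) 0 := rfl
  have hev : Measurable fun y : Finset.Iic 0 → X => y ⟨0, Finset.mem_Iic.2 le_rfl⟩ :=
    measurable_pi_apply _
  rw [Kernel.trajMeasure, h0,
    ← Measure.map_map hev (Preorder.measurable_frestrictLe (X := fun _ => X) 0),
    Measure.map_comp _ _ (Preorder.measurable_frestrictLe (X := fun _ => X) 0),
    Kernel.traj_map_frestrictLe, Kernel.partialTraj_self, Measure.id_comp,
    Measure.map_map hev (by fun_prop)]
  exact Measure.map_id

theorem map_eval_succ_trajMeasure {X : Type*} [MeasurableSpace X] (μ₀ : Measure X)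
    [IsProbabilityMeasure μ₀]
    (κ : (n : ℕ) → Kernel (Finset.Iic n → X) X) [∀ n, IsMarkovKernel (κ n)] (n : ℕ) :
    (Kernel.trajMeasure (X := fun _ => X) μ₀ κ).map (fun x => x (n + 1)) =
      κ n ∘ₘ (Kernel.trajMeasure (X := fun _ => X) μ₀ κ).map
        (Preorder.frestrictLe (π := fun _ => X) n) := by
  have h := congrArg Measure.snd
    (Kernel.map_frestrictLe_trajMeasure_compProd_eq_map_trajMeasure (X := fun _ => X)
      (μ₀ := μ₀) (κ := κ) (a := n))
  rw [Measure.snd_compProd, Measure.snd, Measure.map_map measurable_snd (by fun_prop)] at h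
  exact h.symm

namespace MDP

variable {S A : Type*}
  [TopologicalSpace S] [TopologicalSpace.MetrizableSpace S] [SecondCountableTopology S]
  [MeasurableSpace S] [BorelSpace S]
  [TopologicalSpace A] [TopologicalSpace.MetrizableSpace A] [SecondCountableTopology A]
  [MeasurableSpace A] [BorelSpace A] {M : MDP S A}

/-- By feasibility the product law is carried by `K`, so pulling it back to the subtype loses no
mass. -/
theorem map_val_pairKernel {X : Type*} [MeasurableSpace X] (κ : Kernel X A)
    [IsMarkovKernel κ] (st : X → S) (hst : Measurable st) (h : ∀ x, κ x (M.act (st x)) = 1) :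
    (M.pairKernel κ st hst).map Subtype.val = Kernel.deterministic st hst ×ₖ κ := by
  ext x : 1
  have he := MeasurableEmbedding.subtype_coe M.measurableSet_K
  rw [Kernel.map_apply _ measurable_subtype_coe, pairKernel, Kernel.comapRight_apply,
    he.map_comap, Subtype.range_coe]
  refine Measure.restrict_eq_self_of_ae_mem ((mem_ae_iff_prob_eq_one M.measurableSet_K).2 ?_)
  rw [Kernel.prod_apply, Kernel.deterministic_apply, Measure.prod_apply M.measurableSet_K,
    lintegral_dirac' _ (measurable_measure_prodMk_left M.measurableSet_K)]
  exact h x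

/-- The state component of a feasible pair. -/
def state (k : M.K) : S := k.1.1

theorem continuous_state : Continuous (state : M.K → S) :=
  continuous_fst.comp continuous_subtype_val

theorem measurable_state : Measurable (state : M.K → S) :=
  measurable_fst.comp measurable_subtype_coe

theorem map_state_pairKernel {X : Type*} [MeasurableSpace X] (κ : Kernel X A)
    [IsMarkovKernel κ] (st : X → S) (hst : Measurable st) (h : ∀ x, κ x (M.act (st x)) = 1) :
    (M.pairKernel κ st hst).map state = Kernel.deterministic st hst := by
  rw [← Kernel.fst_prod (Kernel.deterministic st hst) κ, ← map_val_pairKernel κ st hst h,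
    Kernel.fst_eq, ← Kernel.map_comp_right _ measurable_subtype_coe measurable_fst]
  rfl

theorem coe_marginal (μ : ProbabilityMeasure M.K) :
    (marginal μ : Measure S) = (μ : Measure M.K).map state := rfl

theorem continuous_marginal : Continuous (marginal : ProbabilityMeasure M.K → _) :=
  ProbabilityMeasure.continuous_map continuous_state

/-- The flow balance equation `μ̂ = μ Q`. -/
def IsBalanced (μ : ProbabilityMeasure M.K) : Prop := marginal μ = μ.compKernel M.Q

theorem isClosed_setOf_isBalanced (hQ : M.WeaklyContinuous) :
    IsClosed {μ : ProbabilityMeasure M.K | IsBalanced μ} :=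
  isClosed_eq continuous_marginal (continuous_compKernel M.Q hQ)

/-- The law of the history up to time `n + 1` before the action is chosen, given the first
`n + 1` pairs. -/
def historyKernel (M : MDP S A) (n : ℕ) : Kernel (Finset.Iic n → M.K) (M.History (n + 1)) :=
  Kernel.deterministic
      (fun (x : Finset.Iic n → M.K) (i : Fin (n + 1)) =>
        x ⟨i, Finset.mem_Iic.2 (Nat.lt_succ_iff.1 i.2)⟩)
      (measurable_pi_lambda _ fun _ => measurable_pi_apply _) ×ₖ
    M.Q.comap (fun x : Finset.Iic n → M.K => x ⟨n, Finset.mem_Iic.2 le_rfl⟩)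
      (measurable_pi_apply _)

instance (n : ℕ) : IsMarkovKernel (M.historyKernel n) := by
  unfold historyKernel; infer_instance

theorem Policy.step_eq (π : M.Policy) (n : ℕ) :
    π.step n = π.pairLaw (n + 1) ∘ₖ M.historyKernel n := rfl

theorem map_snd_historyKernel (n : ℕ) :
    (M.historyKernel n).map Prod.snd =
      M.Q.comap (fun x : Finset.Iic n → M.K => x ⟨n, Finset.mem_Iic.2 le_rfl⟩)
        (measurable_pi_apply _) := by
  rw [← Kernel.snd_eq]
  exact Kernel.snd_prod _ _

instance (π : M.Policy) (ν : ProbabilityMeasure S) : IsProbabilityMeasure (π.initialLaw ν) := by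
  have : IsProbabilityMeasure ((ν : Measure S).map fun s => ((Fin.elim0 : Fin 0 → M.K), s)) :=
    Measure.isProbabilityMeasure_map (by fun_prop)
  unfold Policy.initialLaw; infer_instance

instance (π : M.Policy) (ν : ProbabilityMeasure S) : IsProbabilityMeasure (π.pathMeasure ν) := by
  unfold Policy.pathMeasure; infer_instance

/-- The law of `(s_t, a_t)`. -/
def Policy.law (π : M.Policy) (ν : ProbabilityMeasure S) (t : ℕ) : ProbabilityMeasure M.K :=
  ⟨(π.pathMeasure ν).map fun ω => ω t,
    Measure.isProbabilityMeasure_map (measurable_pi_apply t).aemeasurable⟩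

/-- The law of the history at time `n + 1`. -/
def Policy.historyLaw (π : M.Policy) (ν : ProbabilityMeasure S) (n : ℕ) :
    Measure (M.History (n + 1)) :=
  M.historyKernel n ∘ₘ (π.pathMeasure ν).map (Preorder.frestrictLe (π := fun _ => M.K) n)

theorem Policy.coe_law_zero (π : M.Policy) (ν : ProbabilityMeasure S) :
    (π.law ν 0 : Measure M.K) = π.initialLaw ν :=
  map_eval_zero_trajMeasure _ _

theorem Policy.coe_law_succ (π : M.Policy) (ν : ProbabilityMeasure S) (n : ℕ) :
    (π.law ν (n + 1) : Measure M.K) = π.pairLaw (n + 1) ∘ₘ π.historyLaw ν n := by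
  rw [Policy.historyLaw, Measure.comp_assoc, ← Policy.step_eq]
  exact map_eval_succ_trajMeasure _ _ n

theorem Policy.map_snd_historyLaw (π : M.Policy) (ν : ProbabilityMeasure S) (n : ℕ) :
    (π.historyLaw ν n).map Prod.snd = M.Q ∘ₘ (π.law ν n : Measure M.K) := by
  rw [Policy.historyLaw, Measure.map_comp _ _ measurable_snd, map_snd_historyKernel,
    ← Kernel.comp_deterministic_eq_comap, ← Measure.comp_assoc,
    Measure.deterministic_comp_eq_map, Measure.map_map (measurable_pi_apply _) (by fun_prop)]
  rfl

/-- Drawing the action leaves the current state unchanged, so the law of the next state depends on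
the policy only through the current pair. -/
theorem Policy.marginal_law_succ (π : M.Policy) (ν : ProbabilityMeasure S) (n : ℕ) :
    marginal (π.law ν (n + 1)) = (π.law ν n).compKernel M.Q := by
  apply ProbabilityMeasure.toMeasure_injective
  rw [coe_marginal, Policy.coe_law_succ, ProbabilityMeasure.coe_compKernel,
    ← Policy.map_snd_historyLaw, Measure.map_comp _ _ measurable_state, Policy.pairLaw,
    map_state_pairKernel _ _ _ (π.feasible (n + 1)), Measure.deterministic_comp_eq_map]

end MDP

/-! ### Occupation measures -/

namespace MDP

variable {S A : Type*}
  [TopologicalSpace S] [TopologicalSpace.MetrizableSpace S] [SecondCountableTopology S]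
  [MeasurableSpace S] [BorelSpace S]
  [TopologicalSpace A] [TopologicalSpace.MetrizableSpace A] [SecondCountableTopology A]
  [MeasurableSpace A] [BorelSpace A] {M : MDP S A}

/-- The expected occupation measure of the times `0, …, n`. -/
def Policy.occupation (π : M.Policy) (ν : ProbabilityMeasure S) (n : ℕ) :
    ProbabilityMeasure M.K :=
  ⟨((n + 1 : ℕ) : ℝ≥0∞)⁻¹ • ∑ t ∈ Finset.range (n + 1), (π.law ν t : Measure M.K), ⟨by
    simp only [Measure.smul_apply, Measure.finsetSum_apply, measure_univ, Finset.sum_const,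
      Finset.card_range, smul_eq_mul, nsmul_eq_mul, mul_one]
    exact ENNReal.inv_mul_cancel (by simp) (ENNReal.natCast_ne_top _)⟩⟩

theorem Policy.coe_occupation (π : M.Policy) (ν : ProbabilityMeasure S) (n : ℕ) :
    (π.occupation ν n : Measure M.K) =
      ((n + 1 : ℕ) : ℝ≥0∞)⁻¹ • ∑ t ∈ Finset.range (n + 1), (π.law ν t : Measure M.K) := rfl

theorem Policy.lintegral_occupation (π : M.Policy) (ν : ProbabilityMeasure S) (n : ℕ)
    (g : M.K → ℝ≥0∞) :
    ∫⁻ k, g k ∂(π.occupation ν n : Measure M.K) =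
      ((n + 1 : ℕ) : ℝ≥0∞)⁻¹ *
        ∑ t ∈ Finset.range (n + 1), ∫⁻ k, g k ∂(π.law ν t : Measure M.K) := by
  rw [Policy.coe_occupation, lintegral_smul_measure, lintegral_finsetSum_measure, smul_eq_mul]

theorem Policy.integral_occupation (π : M.Policy) (ν : ProbabilityMeasure S) (n : ℕ)
    (u : M.K →ᵇ ℝ) :
    ∫ k, u k ∂(π.occupation ν n : Measure M.K) =
      ((n + 1 : ℕ) : ℝ)⁻¹ *
        ∑ t ∈ Finset.range (n + 1), ∫ k, u k ∂(π.law ν t : Measure M.K) := by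
  rw [Policy.coe_occupation, integral_smul_measure,
    integral_finsetSum_measure fun t _ => u.integrable _, smul_eq_mul, ENNReal.toReal_inv,
    ENNReal.toReal_natCast]

/-- For `f ≤ 0` only the negative part survives, and its lower integral is additive without any
integrability condition. -/
theorem longRunAverage_of_nonpos {f : M.K → ℝ} (hf : Measurable f) (hf0 : ∀ k, f k ≤ 0)
    (π : M.Policy) (ν : ProbabilityMeasure S) :
    longRunAverage f π ν =
      liminf (fun n => extExpectation (π.occupation ν n : Measure M.K) f) atTop := by
  -- The horizon `T = n + 1` corresponds to `occupation` at `n`; the shift discards `T = 0`.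
  rw [longRunAverage, ← liminf_nat_add _ 1]
  congr 1
  ext n
  rw [extExpectation_of_nonpos _ hf0,
    extExpectation_of_nonpos _ fun ω => Finset.sum_nonpos fun t _ => hf0 (ω t),
    Policy.lintegral_occupation, mul_neg, EReal.coe_ennreal_mul]
  congr 2
  · rw [← ENNReal.ofReal_natCast, ← ENNReal.ofReal_inv_of_pos (by positivity),
      EReal.coe_ennreal_ofReal, max_eq_left (by positivity), one_div]
  · simp_rw [← Finset.sum_neg_distrib,
      ENNReal.ofReal_sum_of_nonneg fun t _ => neg_nonneg.2 (hf0 _)]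
    rw [lintegral_finsetSum _ fun t _ =>
      (show Measurable fun ω : ℕ → M.K => ENNReal.ofReal (-f (ω t)) from
        (hf.comp (measurable_pi_apply t)).neg.ennreal_ofReal)]
    congr 1
    refine Finset.sum_congr rfl fun t _ => ?_
    exact (lintegral_map hf.neg.ennreal_ofReal (measurable_pi_apply t)).symm

/-- The expected value of `h` in the next state. -/
def transitionBCF (hQ : M.WeaklyContinuous) (h : S →ᵇ ℝ) : M.K →ᵇ ℝ := M.Q.integralBCF hQ h

theorem integral_marginal (μ : ProbabilityMeasure M.K) (h : S →ᵇ ℝ) :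
    ∫ s, h s ∂(marginal μ : Measure S) =
      ∫ k, h.compContinuous ⟨state, continuous_state⟩ k ∂(μ : Measure M.K) :=
  integral_map measurable_state.aemeasurable h.continuous.aestronglyMeasurable

theorem Policy.integral_law_succ (hQ : M.WeaklyContinuous) (π : M.Policy)
    (ν : ProbabilityMeasure S) (n : ℕ) (h : S →ᵇ ℝ) :
    ∫ k, h.compContinuous ⟨state, continuous_state⟩ k ∂(π.law ν (n + 1) : Measure M.K) =
      ∫ k, transitionBCF hQ h k ∂(π.law ν n : Measure M.K) := by
  rw [← integral_marginal, Policy.marginal_law_succ, integral_compKernel]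
  rfl

/-- The expected value of `h` in the next state at time `t` is that of `h` in the state at time `t +
1`. The sum telescopes, leaving at most `2 * ‖h‖` to be divided by `n + 1`. -/
theorem Policy.tendsto_occupation_flow (hQ : M.WeaklyContinuous) (π : M.Policy)
    (ν : ProbabilityMeasure S) (h : S →ᵇ ℝ) :
    Tendsto (fun n => ∫ k, h.compContinuous ⟨state, continuous_state⟩ k
        ∂(π.occupation ν n : Measure M.K) -
      ∫ k, transitionBCF hQ h k ∂(π.occupation ν n : Measure M.K)) atTop (𝓝 0) := by
  have hb (n : ℕ) : ‖∫ k, h.compContinuous ⟨state, continuous_state⟩ k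
      ∂(π.law ν n : Measure M.K)‖ ≤ ‖h‖ := by
    rw [← integral_marginal]
    exact h.norm_integral_le_norm _
  refine squeeze_zero_norm (a := fun n : ℕ => 2 * ‖h‖ * (1 / ((n : ℝ) + 1))) (fun n => ?_)
    (by simpa using tendsto_one_div_add_atTop_nhds_zero_nat.const_mul (2 * ‖h‖))
  simp_rw [Policy.integral_occupation, ← Policy.integral_law_succ hQ, ← mul_sub,
    ← Finset.sum_sub_distrib]
  rw [Finset.sum_range_sub', norm_mul, norm_inv, Real.norm_natCast, mul_comm]
  push_cast
  rw [one_div]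
  gcongr
  exact (norm_sub_le _ _).trans (by linarith [hb 0, hb (n + 1)])

theorem isBalanced_of_tendsto_occupation (hQ : M.WeaklyContinuous) (π : M.Policy)
    (ν : ProbabilityMeasure S) {l : Filter ℕ} [l.NeBot] (hl : l ≤ atTop)
    {μ : ProbabilityMeasure M.K} (hμ : Tendsto (π.occupation ν) l (𝓝 μ)) : IsBalanced μ := by
  apply ProbabilityMeasure.toMeasure_injective
  refine ext_of_forall_integral_eq_of_IsFiniteMeasure fun h => ?_
  rw [integral_marginal, integral_compKernel]
  have hw := ProbabilityMeasure.tendsto_iff_forall_integral_tendsto.1 hμ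
  exact sub_eq_zero.1 (tendsto_nhds_unique
    ((hw (h.compContinuous ⟨state, continuous_state⟩)).sub (hw (transitionBCF hQ h)))
    ((π.tendsto_occupation_flow hQ ν h).mono_left hl))

/-- Long-run averages of a policy with finite average reward are dominated by the expectations
under a probability measure satisfying the flow balance equation. -/
theorem exists_isBalanced_longRunAverage_le (hr_nonpos : ∀ k, M.r k ≤ 0)
    (hr_compact : ∀ ε : ℝ, 0 ≤ ε → IsCompact {k : M.K | -ε ≤ M.r k})
    (hQ : M.WeaklyContinuous) (π : M.Policy) (ν : ProbabilityMeasure S)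
    (hπ : ⊥ < avgReward π ν) :
    ∃ μ : ProbabilityMeasure M.K, IsBalanced μ ∧
      ∀ f : M.K → ℝ, UpperSemicontinuous f → (∀ k, f k ≤ 0) →
        longRunAverage f π ν ≤ extExpectation (μ : Measure M.K) f := by
  obtain ⟨c, -, hc⟩ := EReal.lt_iff_exists_real_btwn.1 hπ
  rw [avgReward, longRunAverage_of_nonpos M.measurable_r hr_nonpos] at hc
  have hev : ∀ᶠ n in (hyperfilter ℕ : Filter ℕ), π.occupation ν n ∈
      {μ : ProbabilityMeasure M.K | (c : EReal) ≤ extExpectation (μ : Measure M.K) M.r} :=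
    ((eventually_lt_of_lt_liminf hc).filter_mono Nat.hyperfilter_le_atTop).mono fun n hn => hn.le
  -- A limit along an ultrafilter gives one measure serving all `f` at once, with no subsequence to
  -- extract.
  obtain ⟨μ, -, hμ⟩ := (isCompact_setOf_le_extExpectation hr_nonpos hr_compact c).ultrafilter_le_nhds
    ((hyperfilter ℕ).map (π.occupation ν)) (le_principal_iff.2 hev)
  refine ⟨μ, isBalanced_of_tendsto_occupation hQ π ν Nat.hyperfilter_le_atTop hμ,
    fun f hf hf0 => ?_⟩
  refine le_of_forall_lt fun y hy => ?_
  -- A value strictly below the liminf is eventually a lower bound; the limit only keeps the weak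
  -- inequality, hence the intermediate `y'`.
  obtain ⟨y', hy', hy'f⟩ := exists_between hy
  rw [longRunAverage_of_nonpos hf.measurable hf0] at hy'f
  have hcl : IsClosed {μ : ProbabilityMeasure M.K | y' ≤ extExpectation (μ : Measure M.K) f} :=
    (upperSemicontinuous_extExpectation hf hf0).isClosed_preimage _
  have hμ' : Tendsto (π.occupation ν) (hyperfilter ℕ : Filter ℕ) (𝓝 μ) := hμ
  have hmem : y' ≤ extExpectation (μ : Measure M.K) f := hcl.mem_of_tendsto hμ' <|
    ((eventually_lt_of_lt_liminf hy'f).filter_mono Nat.hyperfilter_le_atTop).mono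
      fun n hn => hn.le
  exact hy'.trans_le hmem

/-! ### Stationary policies -/

/-- The decision rule of a policy at time `0`, used at all times. -/
def Policy.initialDecision (π : M.Policy) : M.StationaryPolicy where
  dist := (π.dist 0).comap (fun s => (Fin.elim0, s)) (by fun_prop)
  isMarkovKernel_dist := inferInstance
  feasible s := π.feasible 0 (Fin.elim0, s)

theorem map_val_eq_compProd_condKernel [StandardBorelSpace A] [Nonempty A]
    (μ : ProbabilityMeasure M.K) :
    (μ : Measure M.K).map Subtype.val =
      (marginal μ : Measure S) ⊗ₘ ((μ : Measure M.K).map Subtype.val).condKernel := by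
  have : IsProbabilityMeasure ((μ : Measure M.K).map Subtype.val) :=
    Measure.isProbabilityMeasure_map measurable_subtype_coe.aemeasurable
  have h : (marginal μ : Measure S) = ((μ : Measure M.K).map Subtype.val).fst := by
    rw [Measure.fst, Measure.map_map measurable_fst measurable_subtype_coe]
    rfl
  rw [h, Measure.disintegrate]

/-- The conditional kernel of `μ` is feasible only for `μ̂`-almost every state. On the exceptional
measurable set it is replaced by `φ₀`, which does not affect `μ̂ ⊗ₘ φ`. -/
theorem exists_stationaryPolicy_compProd_eq [StandardBorelSpace A] (φ₀ : M.StationaryPolicy)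
    (μ : ProbabilityMeasure M.K) :
    ∃ φ : M.StationaryPolicy,
      (μ : Measure M.K).map Subtype.val = (marginal μ : Measure S) ⊗ₘ φ.dist := by
  obtain ⟨k₀⟩ := μ.nonempty
  have : Nonempty A := ⟨k₀.1.2⟩
  have : IsProbabilityMeasure ((μ : Measure M.K).map Subtype.val) :=
    Measure.isProbabilityMeasure_map measurable_subtype_coe.aemeasurable
  let κ := ((μ : Measure M.K).map Subtype.val).condKernel
  have hs : MeasurableSet {s | κ s (M.act s) = 1} :=
    (Kernel.measurable_kernel_prodMk_left (κ := κ) M.measurableSet_K) (measurableSet_singleton 1)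
  have hK : ∀ᵐ s ∂(marginal μ : Measure S), κ s (M.act s) = 1 := by
    have h : ∀ᵐ p ∂((μ : Measure M.K).map Subtype.val), p ∈ M.K :=
      (ae_map_iff measurable_subtype_coe.aemeasurable M.measurableSet_K).2
        (Eventually.of_forall fun k => k.2)
    rw [map_val_eq_compProd_condKernel] at h
    filter_upwards [Measure.ae_ae_of_ae_compProd h] with s hs
    exact (mem_ae_iff_prob_eq_one (M.measurableSet_act s)).1 hs
  classical
  refine ⟨⟨Kernel.piecewise hs κ φ₀.dist, inferInstance, fun s => ?_⟩, ?_⟩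
  · rw [Kernel.piecewise_apply]
    split_ifs with h
    exacts [h, φ₀.feasible s]
  · refine (map_val_eq_compProd_condKernel μ).trans (Measure.compProd_congr ?_)
    filter_upwards [hK] with s hs
    exact (if_pos hs).symm

theorem pairLaw_comp_marginal {φ : M.StationaryPolicy} {μ : ProbabilityMeasure M.K}
    (h : (μ : Measure M.K).map Subtype.val = (marginal μ : Measure S) ⊗ₘ φ.dist) :
    φ.pairLaw ∘ₘ (marginal μ : Measure S) = (μ : Measure M.K) := by
  have he := MeasurableEmbedding.subtype_coe M.measurableSet_K
  have h' : (φ.pairLaw ∘ₘ (marginal μ : Measure S)).map Subtype.val =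
      (μ : Measure M.K).map Subtype.val := by
    rw [Measure.map_comp _ _ measurable_subtype_coe, StationaryPolicy.pairLaw,
      map_val_pairKernel φ.dist id measurable_id φ.feasible, h, Measure.compProd_eq_comp_prod]
    rfl
  rw [← he.comap_map (φ.pairLaw ∘ₘ (marginal μ : Measure S)), h', he.comap_map]

theorem disintegrates_of_map_val_eq {φ : M.StationaryPolicy} {μ : ProbabilityMeasure M.K}
    (h : (μ : Measure M.K).map Subtype.val = (marginal μ : Measure S) ⊗ₘ φ.dist) :
    Disintegrates μ φ := by
  intro B C hB hC
  rw [← Measure.compProd_apply_prod hB hC, ← h,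
    Measure.map_apply measurable_subtype_coe (hB.prod hC)]
  rfl

theorem StationaryPolicy.pairLaw_toPolicy (φ : M.StationaryPolicy) (t : ℕ) :
    φ.toPolicy.pairLaw t = φ.pairLaw.comap Prod.snd measurable_snd := by
  ext h : 1
  simp only [Policy.pairLaw, StationaryPolicy.pairLaw, pairKernel, Kernel.comapRight_apply,
    Kernel.comap_apply, Kernel.prod_apply, Kernel.deterministic_apply, toPolicy, id]

/-- If the state has law `μ̂`, drawing the action from `φ` gives the pair law `μ`; by balance the
next state again has law `μ̂`. -/
theorem StationaryPolicy.law_toPolicy {φ : M.StationaryPolicy} {μ : ProbabilityMeasure M.K}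
    (h : φ.pairLaw ∘ₘ (marginal μ : Measure S) = (μ : Measure M.K)) (hμ : IsBalanced μ) (t : ℕ) :
    φ.toPolicy.law (marginal μ) t = μ := by
  induction t with
  | zero =>
    apply ProbabilityMeasure.toMeasure_injective
    rw [Policy.coe_law_zero, Policy.initialLaw, pairLaw_toPolicy,
      ← Kernel.comp_deterministic_eq_comap, ← Measure.comp_assoc,
      Measure.deterministic_comp_eq_map, Measure.map_map measurable_snd (by fun_prop)]
    change φ.pairLaw ∘ₘ (marginal μ : Measure S).map id = _
    rw [Measure.map_id, h]
  | succ n ih =>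
    apply ProbabilityMeasure.toMeasure_injective
    rw [Policy.coe_law_succ, pairLaw_toPolicy,
      ← Kernel.comp_deterministic_eq_comap, ← Measure.comp_assoc,
      Measure.deterministic_comp_eq_map, Policy.map_snd_historyLaw, ih,
      ← ProbabilityMeasure.coe_compKernel, ← hμ, h]

theorem StationaryPolicy.longRunAverage_toPolicy {φ : M.StationaryPolicy}
    {μ : ProbabilityMeasure M.K}
    (h : φ.pairLaw ∘ₘ (marginal μ : Measure S) = (μ : Measure M.K)) (hμ : IsBalanced μ)
    {f : M.K → ℝ} (hf : Measurable f) (hf0 : ∀ k, f k ≤ 0) :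
    longRunAverage f φ.toPolicy (marginal μ) = extExpectation (μ : Measure M.K) f := by
  have hocc (n : ℕ) : φ.toPolicy.occupation (marginal μ) n = μ := by
    apply ProbabilityMeasure.toMeasure_injective
    rw [Policy.coe_occupation, Finset.sum_congr rfl fun t _ => by rw [law_toPolicy h hμ t],
      Finset.sum_const, Finset.card_range, ← Nat.cast_smul_eq_nsmul ℝ≥0∞, smul_smul,
      ENNReal.inv_mul_cancel (by simp) (ENNReal.natCast_ne_top _), one_smul]
  simp_rw [longRunAverage_of_nonpos hf hf0, hocc]
  exact liminf_const _

theorem isStable_of_isBalanced {φ : M.StationaryPolicy} {μ : ProbabilityMeasure M.K}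
    (h : (μ : Measure M.K).map Subtype.val = (marginal μ : Measure S) ⊗ₘ φ.dist)
    (hμ : IsBalanced μ) (hr : ⊥ < extExpectation (μ : Measure M.K) M.r) : IsStable μ φ where
  disintegrates := disintegrates_of_map_val_eq h
  reward_gt_bot := hr
  invariant B hB := by
    rw [← Measure.lintegral_bind φ.pairLaw.aemeasurable (M.Q.measurable_coe hB).aemeasurable,
      pairLaw_comp_marginal h, ← Measure.bind_apply hB M.Q.aemeasurable]
    exact congrArg (fun ρ : ProbabilityMeasure S => (ρ : Measure S) B) hμ

theorem upperSemicontinuous_shortfall {z : M.K → ℝ} (hz : UpperSemicontinuous z) (η : ℝ) :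
    UpperSemicontinuous fun k => min (z k - η) 0 :=
  (show Continuous fun x : ℝ => min (x - η) 0 by fun_prop).comp_upperSemicontinuous hz
    fun _ _ h => min_le_min_right _ (sub_le_sub_right h η)

end MDP

end

/-! ### Maximization over balanced measures and transfer back to policies -/

theorem mainTheorem1 {S A Ω : Type*}
    [TopologicalSpace S] [TopologicalSpace.MetrizableSpace S] [SecondCountableTopology S]
    [MeasurableSpace S] [BorelSpace S] [StandardBorelSpace S]
    [TopologicalSpace A] [TopologicalSpace.MetrizableSpace A] [SecondCountableTopology A]
    [MeasurableSpace A] [BorelSpace A] [StandardBorelSpace A]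
    (M : MDP S A) (z : M.K → ℝ)
    [MeasurableSpace Ω] (P : Measure Ω) [IsProbabilityMeasure P]
    (Y : Ω → ℝ) (hY : Measurable Y) (a b : ℝ) (hYab : ∀ᵐ ω ∂P, Y ω ∈ Set.Icc a b)
    (hcons : (M.feasibleRegion z P Y a b).Nonempty)
    (hr_nonpos : ∀ k, M.r k ≤ 0)
    (hr_compact : ∀ ε : ℝ, 0 ≤ ε → IsCompact {k : M.K | -ε ≤ M.r k})
    (hz_bdd : ∃ C : ℝ, ∀ k, |z k| ≤ C)
    (hz_usc : UpperSemicontinuous z)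
    (hQ : M.WeaklyContinuous) :
    M.IsSolvable z P Y a b ∧
      ∃ (φ : M.StationaryPolicy) (μ : ProbabilityMeasure M.K),
        MDP.IsStable μ φ ∧
        (φ.toPolicy, MDP.marginal μ) ∈ M.feasibleRegion z P Y a b ∧
        MDP.avgReward φ.toPolicy (MDP.marginal μ) = M.optimalValue z P Y a b ∧
        extExpectation (μ : Measure M.K) M.r = M.optimalValue z P Y a b := by
  have hr_usc := upperSemicontinuous_of_isCompact_superlevel hr_nonpos hr_compact
  have hs_usc := MDP.upperSemicontinuous_shortfall (M := M) hz_usc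
  have hs_nonpos (η : ℝ) (k : M.K) : min (z k - η) 0 ≤ 0 := min_le_right _ _
  let F : Set (ProbabilityMeasure M.K) := {μ | MDP.IsBalanced μ} ∩ ⋂ η ∈ Set.Icc a b,
    {μ | ((∫ ω, min (Y ω - η) 0 ∂P : ℝ) : EReal) ≤
      extExpectation (μ : Measure M.K) fun k => min (z k - η) 0}
  have hF : IsClosed F := (MDP.isClosed_setOf_isBalanced hQ).inter <|
    isClosed_biInter fun η _ =>
      (upperSemicontinuous_extExpectation (hs_usc η) (hs_nonpos η)).isClosed_preimage _
  have hdom : ∀ p ∈ M.feasibleRegion z P Y a b, ∃ μ ∈ F,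
      MDP.avgReward p.1 p.2 ≤ extExpectation (μ : Measure M.K) M.r := fun p hp => by
    obtain ⟨μ, hμ, hle⟩ :=
      MDP.exists_isBalanced_longRunAverage_le hr_nonpos hr_compact hQ p.1 p.2 hp.1
    exact ⟨μ, ⟨hμ, Set.mem_iInter₂.2 fun η hη =>
      (hp.2 η hη).trans (hle _ (hs_usc η) (hs_nonpos η))⟩, hle _ hr_usc hr_nonpos⟩
  obtain ⟨p₀, hp₀⟩ := hcons
  obtain ⟨c, hc, hcp₀⟩ := EReal.lt_iff_exists_real_btwn.1 hp₀.1
  obtain ⟨μ₀, hμ₀F, hμ₀⟩ := hdom p₀ hp₀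
  -- `F` alone need not be compact. The level `c`, strictly below the reward of a feasible pair,
  -- cuts out a compact nonempty part.
  obtain ⟨μ, ⟨hμc, hμF⟩, hmax⟩ := UpperSemicontinuousOn.exists_isMaxOn
    (s := {μ : ProbabilityMeasure M.K |
      (c : EReal) ≤ extExpectation (μ : Measure M.K) M.r} ∩ F)
    ⟨μ₀, hcp₀.le.trans hμ₀, hμ₀F⟩
    ((isCompact_setOf_le_extExpectation hr_nonpos hr_compact c).inter_right hF)
    ((upperSemicontinuous_extExpectation hr_usc hr_nonpos).upperSemicontinuousOn _)
  have hbot : ⊥ < extExpectation (μ : Measure M.K) M.r := hc.trans_le hμc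
  have hbound : M.optimalValue z P Y a b ≤ extExpectation (μ : Measure M.K) M.r := by
    refine sSup_le ?_
    rintro _ ⟨p, hp, rfl⟩
    obtain ⟨μ', hμ'F, hμ'⟩ := hdom p hp
    -- Measures of `F` below the level `c` lie outside the compact part but cannot beat `μ`.
    rcases le_total (c : EReal) (extExpectation (μ' : Measure M.K) M.r) with h | h
    · exact hμ'.trans (hmax ⟨h, hμ'F⟩)
    · exact hμ'.trans (h.trans hμc)
  -- The first decision rule of the feasible pair supplies the fallback on the exceptional states.
  obtain ⟨φ, hφ⟩ := MDP.exists_stationaryPolicy_compProd_eq p₀.1.initialDecision μ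
  have havg {f : M.K → ℝ} (hf : UpperSemicontinuous f) (hf0 : ∀ k, f k ≤ 0) :=
    MDP.StationaryPolicy.longRunAverage_toPolicy (MDP.pairLaw_comp_marginal hφ) hμF.1
      hf.measurable hf0
  have hreward : MDP.avgReward φ.toPolicy (MDP.marginal μ) =
      extExpectation (μ : Measure M.K) M.r := havg hr_usc hr_nonpos
  have hmem : (φ.toPolicy, MDP.marginal μ) ∈ M.feasibleRegion z P Y a b :=
    ⟨hbot.trans_eq hreward.symm, fun η hη =>
      (Set.mem_iInter₂.1 hμF.2 η hη).trans_eq (havg (hs_usc η) (hs_nonpos η)).symm⟩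
  have hopt : extExpectation (μ : Measure M.K) M.r = M.optimalValue z P Y a b :=
    le_antisymm (hreward.symm.trans_le (le_sSup ⟨_, hmem, rfl⟩)) hbound
  exact ⟨⟨_, hmem, hreward.trans hopt⟩, φ, μ, MDP.isStable_of_isBalanced hφ hμF.1 hbot, hmem,
    hreward.trans hopt, hopt⟩
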